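/- Let $X_1$ and $X_2$ be locally compact Hausdorff spaces and, for $i=1,2$, let $\eta_i : X_i \to X_i$ be a proper continuous map. For a locally compact Hausdorff space $X$ with a proper continuous map $\eta : X \to X$, the semicrossed product $C_0(X)\times_\eta \mathbb{Z}^+$ is defined as follows. For $x \in X$ let $H_x = \ell^2(\mathbb{N})$ be the Hilbert space of square summable complex sequences $\xi = (\xi_n)_{n\ge 0}$, and let \[ \pi_x(f)\xi = \big(f(x)\xi_0,\ f(\eta(x))\xi_1,\ f(\eta^{(2)}(x))\xi_2,\ \dots\big)\quad (f \in C_0(X)),\qquad U_x\xi = (0,\xi_0,\xi_1,\xi_2,\dots), \] where $\eta^{(n)}$ is the $n$-th iterate of $\eta$ and $C_0(X)$ is the algebra of continuous complex-valued functions on $X$ vanishing at infinity. Then $C_0(X)\times_\eta\mathbb{Z}^+$ is the norm closed (not necessarily unital) complex algebra of operators on $\bigoplus_{x\in X} H_x$ (Hilbert space direct sum) generated by all the operators \[ \bigoplus_{x\in X}\pi_x(f), \qquad \bigoplus_{x \in X} U_x\pi_x(g), \qquad f, g \in C_0(X). \] Then the dynamical systems $(X_1,\eta_1)$ and $(X_2,\eta_2)$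 are conjugate, i.e. there is a homeomorphism $h : X_1\to X_2$ with $h\circ\eta_1 = \eta_2\circ h$, if and only if $C_0(X_1)\times_{\eta_1}\mathbb{Z}^+$ and $C_0(X_2)\times_{\eta_2}\mathbb{Z}^+$ are isomorphic as algebras, i.e. there is a bijective, complex-linear, multiplicative map (not assumed continuous) between them. -/

import Mathlib

open scoped ENNReal ZeroAtInfty

noncomputable section

namespace Semicrossed

/-- The Hilbert space `ℓ²(ℕ)` of square summable complex sequences. -/
abbrev L2N : Type := lp (fun _ : ℕ => ℂ) 2

/-- The Hilbert space direct sum `⨁_{x ∈ X} ℓ²(ℕ)`. -/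
abbrev HilbertSum (X : Type*) : Type _ := lp (fun _ : X => L2N) 2

/-- The sequence `(0, ξ₀, ξ₁, ξ₂, …)`. -/
def shiftSeq (ξ : ℕ → ℂ) : ℕ → ℂ
  | 0 => 0
  | n + 1 => ξ n

theorem hasSum_shiftSeq (ξ : L2N) :
    HasSum (fun n => ‖shiftSeq ξ n‖ ^ (2 : ℝ≥0∞).toReal) (‖ξ‖ ^ (2 : ℝ≥0∞).toReal) := by
  have h := lp.hasSum_norm (p := 2) (by norm_num) ξ
  rw [← hasSum_nat_add_iff' 1]
  simpa [shiftSeq] using h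

/-- The forward shift `(ξ₀, ξ₁, …) ↦ (0, ξ₀, ξ₁, …)` on `ℓ²(ℕ)`. -/
def shift : L2N →ₗᵢ[ℂ] L2N where
  toFun ξ := ⟨shiftSeq ξ, memℓp_gen (hasSum_shiftSeq ξ).summable⟩
  map_add' ξ ζ := by
    ext n
    change shiftSeq (⇑ξ + ⇑ζ) n = shiftSeq ξ n + shiftSeq ζ n
    cases n <;> simp [shiftSeq]
  map_smul' c ξ := by
    ext n
    cases n <;> simp [shiftSeq]
  norm_map' ξ := by
    have h := (hasSum_shiftSeq ξ).tsum_eq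
    have h2 := lp.norm_rpow_eq_tsum (p := 2) (by norm_num)
      (⟨shiftSeq ξ, memℓp_gen (hasSum_shiftSeq ξ).summable⟩ : L2N)
    have h3 := h2.trans h
    simpa using h3

variable {X : Type*} [TopologicalSpace X]

theorem norm_apply_smul_id_le (f : C₀(X, ℂ)) (y : X) :
    ‖f y • ContinuousLinearMap.id ℂ ℂ‖ ≤ ‖f‖ := by
  rw [norm_smul, ContinuousLinearMap.norm_id, mul_one, ← ZeroAtInftyContinuousMap.norm_toBCF_eq_norm]
  exact f.toBCF.norm_coe_le_norm y

/-- `π_x(f) (ξ₀, ξ₁, ξ₂, …) = (f(x) ξ₀, f(η(x)) ξ₁, f(η(η(x))) ξ₂, …)`, the diagonal operator on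
`ℓ²(ℕ)` with entries `f (η^[n] x)`. -/
def rep (η : X → X) (f : C₀(X, ℂ)) (x : X) : L2N →L[ℂ] L2N :=
  lp.mapCLM 2 (fun n : ℕ => f (η^[n] x) • ContinuousLinearMap.id ℂ ℂ) (norm_nonneg f)
    (fun n => norm_apply_smul_id_le f (η^[n] x))

theorem norm_rep_le (η : X → X) (f : C₀(X, ℂ)) (x : X) : ‖rep η f x‖ ≤ ‖f‖ :=
  lp.norm_mapCLM_le 2 _ (norm_nonneg f) _

/-- `U_x π_x(g)` with `U_x` the forward shift. -/
def shiftRep (η : X → X) (g : C₀(X, ℂ)) (x : X) : L2N →L[ℂ] L2N :=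
  shift.toContinuousLinearMap ∘L rep η g x

theorem norm_shiftRep_le (η : X → X) (g : C₀(X, ℂ)) (x : X) : ‖shiftRep η g x‖ ≤ ‖g‖ := by
  refine ContinuousLinearMap.opNorm_le_bound _ (norm_nonneg g) fun ξ => ?_
  have h : ‖shiftRep η g x ξ‖ = ‖rep η g x ξ‖ := shift.norm_map _
  rw [h]
  exact (rep η g x).le_of_opNorm_le (norm_rep_le η g x) ξ

/-- `⨁_{x ∈ X} π_x(f)`. -/
def sumRep (η : X → X) (f : C₀(X, ℂ)) : HilbertSum X →L[ℂ] HilbertSum X :=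
  lp.mapCLM 2 (rep η f) (norm_nonneg f) (norm_rep_le η f)

/-- `⨁_{x ∈ X} U_x π_x(g)`. -/
def sumShiftRep (η : X → X) (g : C₀(X, ℂ)) : HilbertSum X →L[ℂ] HilbertSum X :=
  lp.mapCLM 2 (shiftRep η g) (norm_nonneg g) (norm_shiftRep_le η g)

/-- Peters' semicrossed product `C₀(X) ×_η ℤ⁺`: the norm closed (not necessarily unital) complex
algebra of operators on `⨁_{x ∈ X} ℓ²(ℕ)` generated by all `⨁ π_x(f)` and `⨁ U_x π_x(g)`. -/
def semicrossedProduct (η : X → X) :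
    NonUnitalSubalgebra ℂ (HilbertSum X →L[ℂ] HilbertSum X) :=
  (NonUnitalAlgebra.adjoin ℂ
    (Set.range (sumRep η) ∪ Set.range (sumShiftRep η))).topologicalClosure

/-- The systems `(X, η)` and `(Y, θ)` are conjugate: some homeomorphism intertwines the maps. -/
def Conjugate {X Y : Type*} [TopologicalSpace X] [TopologicalSpace Y] (η : X → X) (θ : Y → Y) :
    Prop :=
  ∃ h : X ≃ₜ Y, ∀ x, h (η x) = θ (h x)

/-- Two possibly non-unital complex algebras are isomorphic as algebras: there is a bijective,
complex-linear and multiplicative map (no continuity is required). -/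
def IsomorphicAsAlgebras (A B : Type*) [NonUnitalRing A] [Module ℂ A] [NonUnitalRing B]
    [Module ℂ B] : Prop :=
  ∃ φ : A →ₙₐ[ℂ] B, Function.Bijective φ

end Semicrossed

end

/-! The dynamics can be recovered from purely algebraic data: characters, and derivations over pairs
of characters. Write `U` for the shift, so that `f U = U (f ∘ η)`. Every nonzero character is
contractive and is determined by a pair `(x, w)` with `f ↦ f x`, `U g ↦ w g(x)` and `‖w‖ ≤ 1`; the
covariance relation allows `w ≠ 0` only when `η x = x`. For `‖w‖ < 1` these characters are realised
by the functionals `ξ ↦ ∑ wⁿ ξ(x)(n)`. Thus a fixed point carries a disk of characters, and any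
other point carries one.

A surjective homomorphism pulls characters back. Along a disk this pullback is holomorphic, so the
maximum modulus principle keeps each disk over one point (`eq_pointMap`). Hence an isomorphism
induces a bijection of the spaces. It is continuous because the diagonal coefficient of an element
is a function in `C₀(X)` (`exists_eq_diag_add_shift`), and it preserves fixed points because only
they carry more than one character.

For a nonfixed `y`, the orbit is detected by derivations: over distinct points `p` and `q`, with
second coordinate `0` at `q`, a non-inner derivation forces `q = η p` (`eq_of_derivation`). The
off-diagonal coefficient `tailDerivation` supplies one over `(y, θ y)`, and its parameter can be
tuned so that the character pulled back from `θ y` has second coordinate `0` (`norm_coord_lt_one`,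
`pointMap_comm`).

In the other direction, a conjugacy permutes the summands of the Hilbert space, and conjugation by
that unitary carries generators to generators. -/

open scoped ENNReal ZeroAtInfty

noncomputable section

namespace Semicrossed

open Filter Topology

/-! ### Automatic continuity of characters -/

section Characters

variable {A : Type*} [NonUnitalNormedRing A] [NormedSpace ℂ A] [CompleteSpace A]

/-- Characters of a complete normed algebra are contractive. -/
theorem norm_character_apply_le (χ : A →ₙₐ[ℂ] ℂ) (a : A) : ‖χ a‖ ≤ ‖a‖ := by
  by_contra! hlt
  have hχ : χ a ≠ 0 := fun h => by
    rw [h, norm_zero] at hlt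
    exact (norm_nonneg a).not_gt hlt
  obtain ⟨b, hb1, hb2⟩ : ∃ b : A, χ b = 1 ∧ ‖b‖ < 1 := by
    refine ⟨(χ a)⁻¹ • a, by simp [hχ], ?_⟩
    rw [norm_smul, norm_inv, inv_mul_lt_one₀ (norm_pos_iff.2 hχ)]
    exact hlt
  -- These are the powers `b ^ (n + 1)`, written as iterates since there is no unit. Their sum `s`
  -- satisfies `s = b + b * s`, and applying `χ` gives the absurd `χ s = 1 + χ s`.
  let u : ℕ → A := fun n => (fun c => b * c)^[n] b
  have hu : ∀ n, u (n + 1) = b * u n := fun n => Function.iterate_succ_apply' _ _ _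
  have hbound : ∀ n, ‖u n‖ ≤ ‖b‖ * ‖b‖ ^ n := by
    intro n
    induction n with
    | zero => simp [u]
    | succ n ih =>
      rw [hu]
      calc ‖b * u n‖ ≤ ‖b‖ * ‖u n‖ := norm_mul_le _ _
        _ ≤ ‖b‖ * (‖b‖ * ‖b‖ ^ n) := by gcongr
        _ = ‖b‖ * ‖b‖ ^ (n + 1) := by ring
  have hs : Summable u :=
    Summable.of_norm_bounded ((summable_geometric_of_lt_one (norm_nonneg b) hb2).mul_left ‖b‖) hbound
  have key : (∑' n, u n) = b + b * ∑' n, u n := by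
    refine hs.tsum_eq_zero_add.trans ?_
    simp_rw [hu]
    rw [hs.tsum_mul_left]
    rfl
  have := congrArg χ key
  rw [map_add, map_mul, hb1, one_mul] at this
  simp at this

end Characters

/-! ### Ideals, separation and characters of `C₀(X)` -/

section ZeroAtInfty

variable {X : Type*} [TopologicalSpace X]

theorem norm_zeroAtInfty_apply_le (f : C₀(X, ℂ)) (x : X) : ‖f x‖ ≤ ‖f‖ := by
  rw [← ZeroAtInftyContinuousMap.norm_toBCF_eq_norm]
  exact f.toBCF.norm_coe_le_norm x

theorem norm_zeroAtInfty_le {f : C₀(X, ℂ)} {C : ℝ} (hC : 0 ≤ C) (h : ∀ x, ‖f x‖ ≤ C) :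
    ‖f‖ ≤ C := by
  rw [← ZeroAtInftyContinuousMap.norm_toBCF_eq_norm]
  exact (BoundedContinuousFunction.norm_le hC).2 h

theorem isCompact_le_norm (f : C₀(X, ℂ)) {δ : ℝ} (hδ : 0 < δ) :
    IsCompact {x | δ ≤ ‖f x‖} := by
  have h : ∀ᶠ x in cocompact X, ‖f x‖ < δ := by
    have := f.zero_at_infty'.norm
    rw [norm_zero] at this
    exact this.eventually (gt_mem_nhds hδ)
  obtain ⟨K, hK, hsub⟩ := mem_cocompact.1 h
  refine hK.of_isClosed_subset (isClosed_le continuous_const f.continuous.norm) fun x hx => ?_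
  by_contra hxK
  exact (lt_irrefl δ) (lt_of_le_of_lt hx (hsub hxK))

/-- `f` is within `δ` of the ideal generated by `N ≥ 0` if `N` does not vanish where `f` is large. -/
theorem exists_norm_sub_mul_le (f N : C₀(X, ℂ)) {r : X → ℝ} (hr : ∀ x, 0 ≤ r x)
    (hN : ∀ x, N x = r x) {δ : ℝ} (hδ : 0 < δ) (hpos : ∀ x, δ ≤ ‖f x‖ → N x ≠ 0) :
    ∃ k : C₀(X, ℂ), ‖f - k * N‖ ≤ δ := by
  rcases ({x | δ ≤ ‖f x‖}).eq_empty_or_nonempty with hK | hK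
  · refine ⟨0, norm_zeroAtInfty_le hδ.le fun x => ?_⟩
    have : x ∉ {x | δ ≤ ‖f x‖} := by simp [hK]
    simpa using (not_le.1 this).le
  have hrN : r = fun x => (N x).re := by
    ext x
    simp [hN]
  have hrc : Continuous r := by
    rw [hrN]
    exact Complex.continuous_re.comp N.continuous
  obtain ⟨y, hy, hmin⟩ := (isCompact_le_norm f hδ).exists_isMinOn hK hrc.continuousOn
  have hm : 0 < r y := lt_of_le_of_ne (hr y) fun h => hpos y hy (by rw [hN, ← h]; simp)
  -- With `k = f / (N + ε)` the error is `f ε / (N + ε)`. Where `‖f‖` is small the quotient is at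
  -- most `1`; on the compact set where it is large, `N ≥ r y`, and this `ε` makes the error at most
  -- `δ`.
  set ε : ℝ := δ * r y / (‖f‖ + 1) with hε
  have hε0 : 0 < ε := by positivity
  have hden : ∀ x, (0 : ℝ) < r x + ε := fun x => by
    have := hr x
    positivity
  have hden' : ∀ x, ((r x : ℂ) + ε) ≠ 0 := fun x => by
    exact_mod_cast (hden x).ne'
  let k : C₀(X, ℂ) :=
    { toFun := fun x => f x * ((r x : ℂ) + ε)⁻¹
      continuous_toFun := f.continuous.mul
        (((Complex.continuous_ofReal.comp hrc).add continuous_const).inv₀ hden')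
      zero_at_infty' := by
        refine squeeze_zero_norm (a := fun x => ‖f x‖ * ε⁻¹) (fun x => ?_) ?_
        · rw [norm_mul]
          gcongr
          rw [← Complex.ofReal_add, norm_inv, Complex.norm_real, Real.norm_of_nonneg (hden x).le]
          gcongr
          linarith [hr x]
        · have := f.zero_at_infty'.norm.mul_const ε⁻¹
          simpa using this }
  refine ⟨k, norm_zeroAtInfty_le hδ.le fun x => ?_⟩
  have hval : (f - k * N) x = f x * ((ε / (r x + ε) : ℝ) : ℂ) := by
    change f x - f x * ((r x : ℂ) + ε)⁻¹ * N x = _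
    rw [hN]
    push_cast
    field_simp [hden' x]
    ring
  rw [hval, norm_mul, Complex.norm_real, Real.norm_of_nonneg (div_nonneg hε0.le (hden x).le)]
  by_cases hx : δ ≤ ‖f x‖
  · have h1 : r y ≤ r x := hmin hx
    rw [mul_div_assoc', div_le_iff₀ (hden x)]
    have h2 : ‖f x‖ * ε ≤ (‖f‖ + 1) * ε := by
      gcongr
      linarith [norm_zeroAtInfty_apply_le f x]
    have h3 : (‖f‖ + 1) * ε = δ * r y := by
      rw [hε]
      field_simp
    nlinarith
  · push Not at hx
    have : ε / (r x + ε) ≤ 1 := (div_le_one (hden x)).2 (by linarith [hr x])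
    calc ‖f x‖ * (ε / (r x + ε)) ≤ ‖f x‖ * 1 := by gcongr
      _ ≤ δ := by linarith

/-- Approximate units: every `g` is a limit of elements `k * g`. -/
theorem exists_norm_sub_mul_self_le (g : C₀(X, ℂ)) {δ : ℝ} (hδ : 0 < δ) :
    ∃ k : C₀(X, ℂ), ‖g - k * g‖ ≤ δ := by
  obtain ⟨k, hk⟩ := exists_norm_sub_mul_le g (star g * g) (r := fun x => ‖g x‖ ^ 2)
    (fun x => by positivity) (fun x => by
      simp [Complex.conj_mul']) hδ (fun x hx => by
      have : g x ≠ 0 := norm_pos_iff.1 (hδ.trans_le hx)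
      simpa using this)
  exact ⟨k * star g, by rwa [mul_assoc]⟩

variable [LocallyCompactSpace X] [T2Space X]

theorem exists_zeroAtInfty_eq_one {x : X} {V : Set X} (hV : IsOpen V) (hx : x ∈ V) :
    ∃ f : C₀(X, ℂ), f x = 1 ∧ (∀ y ∉ V, f y = 0) ∧ ‖f‖ ≤ 1 := by
  obtain ⟨f, h1, hc, hs, h01⟩ := exists_continuousMap_one_of_isCompact_subset_isOpen
    (isCompact_singleton (x := x)) hV (Set.singleton_subset_iff.2 hx)
  have hc' : HasCompactSupport f := hc
  refine ⟨⟨⟨fun y => (f y : ℂ), Complex.continuous_ofReal.comp f.continuous⟩, ?_⟩, ?_, ?_, ?_⟩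
  · have : HasCompactSupport (fun y => (f y : ℂ)) := hc'.comp_left (g := Complex.ofReal) (by simp)
    exact this.is_zero_at_infty
  · have := h1 (Set.mem_singleton x)
    change ((f x : ℝ) : ℂ) = 1
    rw [this]
    simp
  · intro y hy
    change ((f y : ℝ) : ℂ) = 0
    rw [image_eq_zero_of_notMem_tsupport fun h => hy (hs h)]
    simp
  · refine norm_zeroAtInfty_le zero_le_one fun y => ?_
    change ‖((f y : ℝ) : ℂ)‖ ≤ 1
    rw [Complex.norm_real, Real.norm_of_nonneg (h01 y).1]
    exact (h01 y).2

theorem exists_zeroAtInfty_separating {x y : X} (hxy : x ≠ y) :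
    ∃ f : C₀(X, ℂ), f x = 1 ∧ f y = 0 ∧ ‖f‖ ≤ 1 := by
  obtain ⟨f, h1, h2, h3⟩ := exists_zeroAtInfty_eq_one (isOpen_compl_singleton (x := y))
    (Set.mem_compl_singleton_iff.2 hxy)
  exact ⟨f, h1, h2 y (by simp), h3⟩

theorem eq_of_zeroAtInfty_apply_eq {x y : X} (h : ∀ f : C₀(X, ℂ), f x = f y) : x = y := by
  by_contra hxy
  obtain ⟨f, h1, h2, -⟩ := exists_zeroAtInfty_separating hxy
  exact one_ne_zero (h1.symm.trans ((h f).trans h2))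

theorem exists_zeroAtInfty_apply_eq_one (x : X) : ∃ f : C₀(X, ℂ), f x = 1 ∧ ‖f‖ ≤ 1 := by
  obtain ⟨f, h1, -, h2⟩ := exists_zeroAtInfty_eq_one isOpen_univ (Set.mem_univ x)
  exact ⟨f, h1, h2⟩

/-- The nonzero characters of `C₀(X)` are the point evaluations. -/
theorem exists_eq_eval_of_character (χ : C₀(X, ℂ) →ₙₐ[ℂ] ℂ) (hχ : ∃ f, χ f ≠ 0) :
    ∃ x, ∀ f, χ f = f x := by
  have hker : ∃ x, ∀ f, χ f = 0 → f x = 0 := by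
    by_contra! h
    choose F hF0 hF using h
    obtain ⟨f, hf⟩ : ∃ f, χ f = 1 := by
      obtain ⟨f, hf⟩ := hχ
      exact ⟨(χ f)⁻¹ • f, by simp [hf]⟩
    -- The sum of `|F x|²` over `t` lies in the kernel and is positive where `|f| ≥ 1/2`. So `f` is
    -- within `1/2` of the kernel, contradicting `χ f = 1` and contractivity.
    obtain ⟨t, ht⟩ := (isCompact_le_norm f (half_pos one_pos)).elim_finite_subcover
      (fun x => {y | F x y ≠ 0}) (fun x => isOpen_ne_fun (F x).continuous continuous_const)
      (fun x _ => Set.mem_iUnion.2 ⟨x, hF x⟩)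
    have hNx : ∀ y, (∑ x ∈ t, star (F x) * F x) y = ((∑ x ∈ t, ‖F x y‖ ^ 2 : ℝ) : ℂ) := by
      intro y
      have : ∀ s : Finset X, (∑ x ∈ s, star (F x) * F x) y
          = ((∑ x ∈ s, ‖F x y‖ ^ 2 : ℝ) : ℂ) := by
        intro s
        classical
        induction s using Finset.induction_on with
        | empty => simp
        | insert a s ha ih =>
          rw [Finset.sum_insert ha, Finset.sum_insert ha, ZeroAtInftyContinuousMap.add_apply, ih]
          simp [Complex.conj_mul']
      exact this t
    obtain ⟨k, hk⟩ := exists_norm_sub_mul_le f (∑ x ∈ t, star (F x) * F x)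
      (r := fun y => ∑ x ∈ t, ‖F x y‖ ^ 2) (fun y => by positivity) hNx (half_pos one_pos)
      (fun y hy => by
        rw [hNx]
        obtain ⟨x, hx, hxy⟩ := Set.mem_iUnion₂.1 (ht hy)
        have : 0 < ∑ x ∈ t, ‖F x y‖ ^ 2 :=
          Finset.sum_pos' (fun i _ => by positivity) ⟨x, hx, by
            have := norm_pos_iff.2 hxy
            positivity⟩
        exact_mod_cast this.ne')
    have h1 := norm_character_apply_le χ (f - k * ∑ x ∈ t, star (F x) * F x)
    have h2 : χ (∑ x ∈ t, star (F x) * F x) = 0 := by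
      rw [map_sum]
      exact Finset.sum_eq_zero fun x _ => by rw [map_mul, hF0, mul_zero]
    rw [map_sub, map_mul, h2, hf] at h1
    norm_num at h1
    linarith
  obtain ⟨x, hx⟩ := hker
  obtain ⟨f, hf⟩ := hχ
  -- The kernel of `χ` lies in that of evaluation at `x`, so the two functionals are proportional;
  -- multiplicativity then makes them equal.
  have hmul : ∀ g, χ g * f x = χ f * g x := fun g => by
    have := hx (χ g • f - χ f • g) (by simp [mul_comm])
    simpa [sub_eq_zero] using this
  have hfx : f x = χ f := by
    have := hmul (f * f)
    simp only [map_mul, ZeroAtInftyContinuousMap.mul_apply] at this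
    have hfx0 : f x ≠ 0 := fun h0 => by
      obtain ⟨g, hg, -⟩ := exists_zeroAtInfty_apply_eq_one x
      have := hmul g
      rw [h0, mul_zero, hg, mul_one] at this
      exact hf this.symm
    have h3 : χ f * f x * (χ f - f x) = 0 := by linear_combination this
    rcases mul_eq_zero.1 h3 with h | h
    · exact absurd h (mul_ne_zero hf hfx0)
    · exact (sub_eq_zero.1 h).symm
  refine ⟨x, fun g => ?_⟩
  have := hmul g
  rw [hfx, mul_comm] at this
  exact mul_left_cancel₀ hf this

/-- `X` carries the initial topology of `C₀(X)`. -/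
theorem continuous_of_zeroAtInfty_comp {Y : Type*} [TopologicalSpace Y] (h : Y → X)
    (hc : ∀ f : C₀(X, ℂ), Continuous fun y => f (h y)) : Continuous h := by
  refine continuous_iff_continuousAt.2 fun y => ?_
  intro U hU
  obtain ⟨V, hVU, hV, hy⟩ := mem_nhds_iff.1 hU
  obtain ⟨f, h1, h0, -⟩ := exists_zeroAtInfty_eq_one hV hy
  have : {z | f (h z) ≠ 0} ∈ 𝓝 y :=
    (isOpen_ne_fun (hc f) continuous_const).mem_nhds (by simp [h1])
  refine mem_map.2 (mem_of_superset this fun z hz => hVU ?_)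
  by_contra hzV
  exact hz (h0 _ hzV)

end ZeroAtInfty

/-! ### The operators and the decomposition `f + U b` -/

section

section HilbertSum

variable {X : Type*}

theorem hilbertSum_ext {ξ ζ : HilbertSum X} (h : ∀ x n, ξ x n = ζ x n) : ξ = ζ := by
  ext x n
  exact h x n

/-- The direct sum of the forward shifts. -/
def sumShift : HilbertSum X →ₗᵢ[ℂ] HilbertSum X where
  toLinearMap := (lp.mapCLM 2 (fun _ : X => shift.toContinuousLinearMap) zero_le_one
    fun _ => shift.norm_toContinuousLinearMap_le).toLinearMap
  norm_map' ξ := by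
    have h2 : (0 : ℝ) < (2 : ℝ≥0∞).toReal := by norm_num
    refine (Real.rpow_left_inj (norm_nonneg _) (norm_nonneg _) h2.ne').1 ?_
    rw [lp.norm_rpow_eq_tsum h2, lp.norm_rpow_eq_tsum h2]
    refine tsum_congr fun x => ?_
    congr 1
    exact shift.norm_map (ξ x)

theorem sumShift_apply_zero (ξ : HilbertSum X) (x : X) : sumShift ξ x 0 = 0 := rfl

theorem sumShift_apply_succ (ξ : HilbertSum X) (x : X) (n : ℕ) :
    sumShift ξ x (n + 1) = ξ x n := rfl

/-- The unit vector at position `0` of the summand indexed by `x`. -/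
def vacuum (x : X) : HilbertSum X := by
  classical exact lp.single 2 x (lp.single 2 0 1)

theorem vacuum_apply_zero (x : X) : vacuum x x 0 = 1 := by
  simp [vacuum]

theorem vacuum_apply_succ (x : X) (n : ℕ) : vacuum x x (n + 1) = 0 := by
  simp [vacuum]

theorem norm_vacuum (x : X) : ‖vacuum x‖ = 1 := by
  simp [vacuum, lp.norm_single]

theorem norm_apply_apply_le (ξ : HilbertSum X) (x : X) (n : ℕ) : ‖ξ x n‖ ≤ ‖ξ‖ :=
  (lp.norm_apply_le_norm two_ne_zero (ξ x) n).trans (lp.norm_apply_le_norm two_ne_zero ξ x)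

end HilbertSum

variable {X : Type*} [TopologicalSpace X] {η : X → X}

section Operators

theorem sumRep_apply (η : X → X) (f : C₀(X, ℂ)) (ξ : HilbertSum X) (x : X) (n : ℕ) :
    sumRep η f ξ x n = f (η^[n] x) * ξ x n := by
  simp [sumRep, rep]

theorem sumShiftRep_apply_zero (η : X → X) (g : C₀(X, ℂ)) (ξ : HilbertSum X) (x : X) :
    sumShiftRep η g ξ x 0 = 0 := rfl

theorem sumShiftRep_apply_succ (η : X → X) (g : C₀(X, ℂ)) (ξ : HilbertSum X) (x : X) (n : ℕ) :
    sumShiftRep η g ξ x (n + 1) = g (η^[n] x) * ξ x n := by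
  change rep η g x (ξ x) n = _
  simp [rep]

theorem sumShiftRep_eq (η : X → X) (g : C₀(X, ℂ)) :
    sumShiftRep η g = sumShift.toContinuousLinearMap * sumRep η g := rfl

theorem sumRep_add (η : X → X) (f g : C₀(X, ℂ)) :
    sumRep η (f + g) = sumRep η f + sumRep η g := by
  refine ContinuousLinearMap.ext fun ξ => hilbertSum_ext fun x n => ?_
  change _ = sumRep η f ξ x n + sumRep η g ξ x n
  simp [sumRep_apply, add_mul]

theorem sumRep_smul (η : X → X) (c : ℂ) (f : C₀(X, ℂ)) :
    sumRep η (c • f) = c • sumRep η f := by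
  refine ContinuousLinearMap.ext fun ξ => hilbertSum_ext fun x n => ?_
  change _ = c * sumRep η f ξ x n
  simp [sumRep_apply, mul_assoc]

theorem sumRep_mul (η : X → X) (f g : C₀(X, ℂ)) :
    sumRep η (f * g) = sumRep η f * sumRep η g := by
  refine ContinuousLinearMap.ext fun ξ => hilbertSum_ext fun x n => ?_
  change _ = sumRep η f (sumRep η g ξ) x n
  simp [sumRep_apply, mul_assoc]

theorem norm_sumRep_le (η : X → X) (f : C₀(X, ℂ)) : ‖sumRep η f‖ ≤ ‖f‖ :=
  lp.norm_mapCLM_le 2 _ (norm_nonneg f) _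

/-- Composition of a function vanishing at infinity with a proper map. -/
def pullback (hη : IsProperMap η) (f : C₀(X, ℂ)) : C₀(X, ℂ) :=
  f.comp ⟨⟨η, hη.continuous⟩, fun s hs => by
    obtain ⟨K, hK, h⟩ := mem_cocompact.1 hs
    exact mem_cocompact.2 ⟨η ⁻¹' K, hη.isCompact_preimage hK, fun x hx => h hx⟩⟩

theorem pullback_apply (hη : IsProperMap η) (f : C₀(X, ℂ)) (x : X) :
    pullback hη f x = f (η x) := rfl

/-- The covariance relation: entry `n + 1` of the diagonal at `x` is `f (η (η^[n] x))`. -/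
theorem sumRep_mul_sumShift (hη : IsProperMap η) (f : C₀(X, ℂ)) :
    sumRep η f * sumShift.toContinuousLinearMap =
      sumShift.toContinuousLinearMap * sumRep η (pullback hη f) := by
  refine ContinuousLinearMap.ext fun ξ => hilbertSum_ext fun x n => ?_
  change sumRep η f (sumShift ξ) x n = sumShift (sumRep η (pullback hη f) ξ) x n
  cases n with
  | zero => simp [sumRep_apply, sumShift_apply_zero]
  | succ n =>
    rw [sumRep_apply, sumShift_apply_succ, sumShift_apply_succ, sumRep_apply, pullback_apply,
      Function.iterate_succ_apply']

end Operators

section Algebra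

theorem sumRep_mem (η : X → X) (f : C₀(X, ℂ)) : sumRep η f ∈ semicrossedProduct η :=
  NonUnitalSubalgebra.le_topologicalClosure _
    (NonUnitalAlgebra.subset_adjoin ℂ (Or.inl ⟨f, rfl⟩))

theorem sumShiftRep_mem (η : X → X) (g : C₀(X, ℂ)) : sumShiftRep η g ∈ semicrossedProduct η :=
  NonUnitalSubalgebra.le_topologicalClosure _
    (NonUnitalAlgebra.subset_adjoin ℂ (Or.inr ⟨g, rfl⟩))

theorem isClosed_semicrossedProduct (η : X → X) :
    IsClosed (semicrossedProduct η : Set (HilbertSum X →L[ℂ] HilbertSum X)) :=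
  NonUnitalSubalgebra.isClosed_topologicalClosure _

instance (η : X → X) : CompleteSpace (semicrossedProduct η) :=
  (isClosed_semicrossedProduct η).completeSpace_coe

instance (η : X → X) : NormedSpace ℂ (semicrossedProduct η) :=
  { norm_smul_le := fun c a => norm_smul_le c (a : HilbertSum X →L[ℂ] HilbertSum X) }

/-- The copy of `C₀(X)` in the semicrossed product. -/
def diag (η : X → X) : C₀(X, ℂ) →ₙₐ[ℂ] semicrossedProduct η where
  toFun f := ⟨sumRep η f, sumRep_mem η f⟩
  map_smul' c f := Subtype.ext (sumRep_smul η c f)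
  map_zero' := Subtype.ext (by simpa using sumRep_smul η 0 0)
  map_add' f g := Subtype.ext (sumRep_add η f g)
  map_mul' f g := Subtype.ext (sumRep_mul η f g)

/-- The generators `U g` of the semicrossed product. -/
def off (η : X → X) (g : C₀(X, ℂ)) : semicrossedProduct η :=
  ⟨sumShiftRep η g, sumShiftRep_mem η g⟩

theorem norm_off_le (η : X → X) (g : C₀(X, ℂ)) : ‖off η g‖ ≤ ‖g‖ :=
  lp.norm_mapCLM_le 2 _ (norm_nonneg g) (norm_shiftRep_le η g)

theorem off_sub (η : X → X) (f g : C₀(X, ℂ)) : off η (f - g) = off η f - off η g := by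
  refine Subtype.ext ?_
  change sumShiftRep η (f - g) = sumShiftRep η f - sumShiftRep η g
  rw [sumShiftRep_eq, sumShiftRep_eq, sumShiftRep_eq, ← mul_sub, sub_eq_add_neg,
    sub_eq_add_neg, ← neg_one_smul ℂ g, sumRep_add, sumRep_smul, neg_one_smul]

theorem off_mul_diag (η : X → X) (f g : C₀(X, ℂ)) : off η f * diag η g = off η (f * g) := by
  refine Subtype.ext ?_
  change sumShiftRep η f * sumRep η g = sumShiftRep η (f * g)
  rw [sumShiftRep_eq, sumShiftRep_eq, sumRep_mul, mul_assoc]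

theorem diag_mul_off (hη : IsProperMap η) (f g : C₀(X, ℂ)) :
    diag η f * off η g = off η g * diag η (pullback hη f) := by
  rw [off_mul_diag]
  refine Subtype.ext ?_
  change sumRep η f * sumShiftRep η g = sumShiftRep η (g * _)
  rw [sumShiftRep_eq, sumShiftRep_eq, ← mul_assoc, sumRep_mul_sumShift hη, mul_assoc,
    ← sumRep_mul, mul_comm g]

/-- Induction principle for closed properties of elements of the semicrossed product. -/
theorem semicrossedProduct_induction {p : semicrossedProduct η → Prop}
    (hp : IsClosed {a | p a}) (hdiag : ∀ f, p (diag η f)) (hoff : ∀ g, p (off η g))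
    (hadd : ∀ a b, p a → p b → p (a + b)) (hsmul : ∀ (c : ℂ) a, p a → p (c • a))
    (hmul : ∀ a b, p a → p b → p (a * b)) (a : semicrossedProduct η) : p a := by
  have hcl : IsClosed ((↑) '' {a : semicrossedProduct η | p a} :
      Set (HilbertSum X →L[ℂ] HilbertSum X)) :=
    (isClosed_semicrossedProduct η).isClosedMap_subtype_val _ hp
  have hsub : (NonUnitalAlgebra.adjoin ℂ (Set.range (sumRep η) ∪ Set.range (sumShiftRep η)) :
      Set (HilbertSum X →L[ℂ] HilbertSum X)) ⊆ (↑) '' {a : semicrossedProduct η | p a} := by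
    intro b hb
    induction hb using NonUnitalAlgebra.adjoin_induction with
    | mem x hx =>
      rcases hx with ⟨f, rfl⟩ | ⟨g, rfl⟩
      · exact ⟨_, hdiag f, rfl⟩
      · exact ⟨_, hoff g, rfl⟩
    | add x y _ _ hx hy =>
      obtain ⟨a, ha, rfl⟩ := hx
      obtain ⟨b, hb, rfl⟩ := hy
      exact ⟨_, hadd a b ha hb, rfl⟩
    | zero => exact ⟨_, hdiag 0, by rw [map_zero]; rfl⟩
    | mul x y _ _ hx hy =>
      obtain ⟨a, ha, rfl⟩ := hx
      obtain ⟨b, hb, rfl⟩ := hy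
      exact ⟨_, hmul a b ha hb, rfl⟩
    | smul c x _ hx =>
      obtain ⟨a, ha, rfl⟩ := hx
      exact ⟨_, hsmul c a ha, rfl⟩
  obtain ⟨b, hb, hba⟩ := closure_minimal hsub hcl a.2
  rwa [← Subtype.ext hba]

/-- Every element of the semicrossed product is of the form `f + U b`. -/
theorem exists_eq_diag_add_shift (hη : IsProperMap η) (a : semicrossedProduct η) :
    ∃ (f : C₀(X, ℂ)) (b : semicrossedProduct η),
      (a : HilbertSum X →L[ℂ] HilbertSum X) =
        sumRep η f + sumShift.toContinuousLinearMap * (b : HilbertSum X →L[ℂ] HilbertSum X) := by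
  -- Such sums have closed range: `f` is read off from the vacuum vectors and `U` is isometric, so
  -- `Φ` is bounded below. Induction over generators then suffices.
  let Φ : C₀(X, ℂ) × semicrossedProduct η → (HilbertSum X →L[ℂ] HilbertSum X) := fun q =>
    sumRep η q.1 + sumShift.toContinuousLinearMap * (q.2 : HilbertSum X →L[ℂ] HilbertSum X)
  have hsub : ∀ q r, Φ (q - r) = Φ q - Φ r := by
    intro q r
    change sumRep η (q.1 - r.1) + sumShift.toContinuousLinearMap *
      ((q.2 : HilbertSum X →L[ℂ] HilbertSum X) -
        (r.2 : HilbertSum X →L[ℂ] HilbertSum X)) = _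
    rw [sub_eq_add_neg q.1, ← neg_one_smul ℂ r.1, sumRep_add, sumRep_smul, mul_sub, neg_one_smul]
    simp only [Φ]
    abel
  have hUb : ∀ T : HilbertSum X →L[ℂ] HilbertSum X,
      ‖(sumShift (X := X)).toContinuousLinearMap * T‖ = ‖T‖ := fun T =>
    sumShift.norm_toContinuousLinearMap_comp
  have h1 : ∀ q, ‖q.1‖ ≤ ‖Φ q‖ := fun q => norm_zeroAtInfty_le (norm_nonneg _) fun x => by
    have e1 : Φ q (vacuum x) x 0 = q.1 x := by
      change sumRep η q.1 (vacuum x) x 0 + 0 = _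
      rw [sumRep_apply, vacuum_apply_zero]
      simp
    rw [← e1]
    refine (norm_apply_apply_le _ _ _).trans ?_
    simpa [norm_vacuum] using (Φ q).le_opNorm (vacuum x)
  have h2 : ∀ q, ‖q.2‖ ≤ 2 * ‖Φ q‖ := fun q => by
    have e2 : sumShift.toContinuousLinearMap * (q.2 : HilbertSum X →L[ℂ] HilbertSum X) =
      Φ q - sumRep η q.1 := by simp [Φ]
    calc ‖q.2‖ = ‖sumShift.toContinuousLinearMap * (q.2 : HilbertSum X →L[ℂ] HilbertSum X)‖ :=
          (hUb _).symm
      _ ≤ ‖Φ q‖ + ‖sumRep η q.1‖ := by rw [e2]; exact norm_sub_le _ _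
      _ ≤ 2 * ‖Φ q‖ := by linarith [norm_sumRep_le η q.1, h1 q]
  have hanti : AntilipschitzWith 2 Φ := AntilipschitzWith.of_le_mul_dist fun q r => by
    rw [dist_eq_norm, dist_eq_norm, ← hsub]
    refine max_le ((h1 _).trans ?_) (h2 _)
    have := norm_nonneg (Φ (q - r))
    push_cast
    linarith
  have hlip : LipschitzWith 2 Φ := LipschitzWith.of_dist_le_mul fun q r => by
    rw [dist_eq_norm, dist_eq_norm, ← hsub]
    refine (norm_add_le _ _).trans ?_
    rw [hUb]
    have h3 : ‖(q - r).1‖ ≤ ‖q - r‖ := norm_fst_le _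
    have h4 : ‖(q - r).2‖ ≤ ‖q - r‖ := norm_snd_le _
    refine (add_le_add ((norm_sumRep_le η (q - r).1).trans h3) h4).trans_eq ?_
    exact (two_mul _).symm
  have hcl : IsClosed (Set.range Φ) := hanti.isClosed_range hlip.uniformContinuous
  suffices h : (a : HilbertSum X →L[ℂ] HilbertSum X) ∈ Set.range Φ by
    obtain ⟨q, hq⟩ := h
    exact ⟨q.1, q.2, hq.symm⟩
  induction a using semicrossedProduct_induction with
  | hp => exact hcl.preimage continuous_subtype_val
  | hdiag f => exact ⟨(f, 0), by simp [Φ, diag]⟩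
  | hoff g => exact ⟨(0, diag η g), by
      have : sumRep η 0 = 0 := by simpa using sumRep_smul η 0 0
      simp [Φ, this, diag, off, sumShiftRep_eq]⟩
  | hadd a b ha hb =>
    obtain ⟨q, hq⟩ := ha
    obtain ⟨r, hr⟩ := hb
    refine ⟨q + r, ?_⟩
    change sumRep η (q.1 + r.1) + _ * ((q.2 : HilbertSum X →L[ℂ] HilbertSum X) + r.2) =
      (a : HilbertSum X →L[ℂ] HilbertSum X) + b
    rw [← hq, ← hr, sumRep_add, mul_add]
    simp only [Φ]
    abel
  | hsmul c a ha =>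
    obtain ⟨q, hq⟩ := ha
    refine ⟨c • q, ?_⟩
    change sumRep η (c • q.1) + _ * (c • (q.2 : HilbertSum X →L[ℂ] HilbertSum X)) =
      c • (a : HilbertSum X →L[ℂ] HilbertSum X)
    rw [← hq, sumRep_smul, mul_smul_comm]
    simp only [Φ, smul_add]
  | hmul a b ha hb =>
    obtain ⟨q, hq⟩ := ha
    obtain ⟨r, hr⟩ := hb
    -- Expand `(f + U c) b` with `b = g + U d` only next to `f`: it is `f g + U ((f ∘ η) d + c b)`.
    refine ⟨(q.1 * r.1, q.2 * b + diag η (pullback hη q.1) * r.2), ?_⟩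
    change sumRep η (q.1 * r.1) + _ * ((q.2 : HilbertSum X →L[ℂ] HilbertSum X) * b +
      sumRep η (pullback hη q.1) * r.2) = (a : HilbertSum X →L[ℂ] HilbertSum X) * b
    rw [← hq, sumRep_mul, mul_add, ← mul_assoc _ (sumRep η (pullback hη q.1)),
      ← sumRep_mul_sumShift hη]
    simp only [Φ]
    rw [add_mul, ← mul_assoc _ (q.2 : HilbertSum X →L[ℂ] HilbertSum X)]
    conv_rhs => rw [← hr]
    simp only [Φ, mul_add, mul_assoc, ← hr]
    abel

end Algebra

end

/-! ### Power series functionals, disk characters and derivations -/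

section

section Functionals

theorem hasSum_of_eq {f g : ℕ → ℂ} {c : ℂ} (hg : HasSum g c) (h : ∀ n, f n = g n) : HasSum f c :=
  (funext h : f = g) ▸ hg

/-- The sequence of powers of the conjugate of `z`. -/
def powSeq {z : ℂ} (hz : ‖z‖ < 1) : L2N :=
  ⟨fun n => (starRingEnd ℂ z) ^ n, memℓp_gen (by
    have : ‖z‖ ^ 2 < 1 := by nlinarith [norm_nonneg z]
    refine (summable_geometric_of_lt_one (by positivity) this).congr fun n => ?_
    simp [← pow_mul, mul_comm])⟩

variable {X : Type*}

/-- `ξ ↦ ∑ zⁿ ξ(x)(n)`. -/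
def powFunctional (x : X) {z : ℂ} (hz : ‖z‖ < 1) : HilbertSum X →L[ℂ] ℂ :=
  innerSL ℂ (powSeq hz) ∘L lp.evalCLM ℂ (fun _ : X => L2N) 2 x

/-- `ξ ↦ ∑ zⁿ ξ(x)(n + 1)`. -/
def tailFunctional (x : X) {z : ℂ} (hz : ‖z‖ < 1) : HilbertSum X →L[ℂ] ℂ :=
  innerSL ℂ (shift (powSeq hz)) ∘L lp.evalCLM ℂ (fun _ : X => L2N) 2 x

theorem hasSum_powFunctional (x : X) {z : ℂ} (hz : ‖z‖ < 1) (ξ : HilbertSum X) :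
    HasSum (fun n => z ^ n * ξ x n) (powFunctional x hz ξ) := by
  refine hasSum_of_eq (lp.hasSum_inner (𝕜 := ℂ) (powSeq hz) (ξ x)) fun n => ?_
  simp [powSeq, mul_comm]

theorem hasSum_tailFunctional (x : X) {z : ℂ} (hz : ‖z‖ < 1) (ξ : HilbertSum X) :
    HasSum (fun n => z ^ n * ξ x (n + 1)) (tailFunctional x hz ξ) := by
  have h := lp.hasSum_inner (𝕜 := ℂ) (shift (powSeq hz)) (ξ x)
  rw [← hasSum_nat_add_iff' 1] at h
  have h0 : shift (powSeq hz) 0 = 0 := rfl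
  have h1 : ∀ n, shift (powSeq hz) (n + 1) = (starRingEnd ℂ z) ^ n := fun _ => rfl
  simp only [Finset.sum_range_one, h0, inner_zero_left, sub_zero, h1] at h
  refine hasSum_of_eq h fun n => ?_
  simp [mul_comm]

theorem powFunctional_vacuum (x : X) {z : ℂ} (hz : ‖z‖ < 1) : powFunctional x hz (vacuum x) = 1 := by
  refine (hasSum_powFunctional x hz _).unique ?_
  have := hasSum_single (f := fun n => z ^ n * vacuum x x n) 0 fun n hn => by
    obtain ⟨m, rfl⟩ := Nat.exists_eq_succ_of_ne_zero hn
    simp [vacuum_apply_succ]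
  simpa [vacuum_apply_zero] using this

theorem tailFunctional_vacuum (x : X) {z : ℂ} (hz : ‖z‖ < 1) :
    tailFunctional x hz (vacuum x) = 0 := by
  refine (hasSum_tailFunctional x hz _).unique ?_
  simp [vacuum_apply_succ, hasSum_zero]

theorem powFunctional_zero (x : X) (ξ : HilbertSum X) :
    powFunctional x (z := 0) (by simp) ξ = ξ x 0 := by
  refine (hasSum_powFunctional x _ _).unique ?_
  have := hasSum_single (f := fun n => (0 : ℂ) ^ n * ξ x n) 0 fun n hn => by simp [hn]
  simpa using this

theorem differentiableOn_tsum_pow (x : X) (ξ : HilbertSum X) :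
    DifferentiableOn ℂ (fun z => ∑' n, z ^ n * ξ x n) (Metric.ball 0 1) := by
  intro z hz
  obtain ⟨r, hzr, hr⟩ := exists_between (mem_ball_zero_iff.1 hz)
  have hr0 : 0 ≤ r := (norm_nonneg z).trans hzr.le
  have h := Complex.differentiableOn_tsum_of_summable_norm (F := fun n z => z ^ n * ξ x n)
    (U := Metric.ball (0 : ℂ) r)
    ((summable_geometric_of_lt_one hr0 hr).mul_right ‖ξ‖)
    (fun n => by fun_prop) Metric.isOpen_ball (fun n w hw => by
      rw [norm_mul, norm_pow]
      gcongr
      · exact (mem_ball_zero_iff.1 hw).le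
      · exact norm_apply_apply_le ξ x n)
  exact (h.differentiableAt (Metric.isOpen_ball.mem_nhds (by simpa using hzr))).differentiableWithinAt

end Functionals

variable {X : Type*} [TopologicalSpace X] {η : X → X}

section Characters

/-- At a fixed point the diagonal is constant along the orbit; for `z = 0` only the entry `n = 0`
counts, since `0 ^ 0 = 1`. -/
theorem powFunctional_sumRep {x : X} {z : ℂ} (hz : ‖z‖ < 1) (hx : z = 0 ∨ η x = x)
    (f : C₀(X, ℂ)) (ξ : HilbertSum X) :
    powFunctional x hz (sumRep η f ξ) = f x * powFunctional x hz ξ := by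
  refine (hasSum_powFunctional x hz _).unique ?_
  refine hasSum_of_eq ((hasSum_powFunctional x hz ξ).mul_left (f x)) fun n => ?_
  rw [sumRep_apply]
  rcases hx with rfl | hx
  · cases n <;> simp
  · rw [Function.iterate_fixed hx]
    ring

theorem powFunctional_sumShiftRep {x : X} {z : ℂ} (hz : ‖z‖ < 1) (hx : z = 0 ∨ η x = x)
    (g : C₀(X, ℂ)) (ξ : HilbertSum X) :
    powFunctional x hz (sumShiftRep η g ξ) = z * g x * powFunctional x hz ξ := by
  have h := hasSum_powFunctional x hz (sumShiftRep η g ξ)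
  rw [← hasSum_nat_add_iff' 1] at h
  simp only [Finset.sum_range_one, sumShiftRep_apply_zero, mul_zero, sub_zero,
    sumShiftRep_apply_succ] at h
  refine h.unique ?_
  refine hasSum_of_eq ((hasSum_powFunctional x hz ξ).mul_left (z * g x)) fun n => ?_
  rcases hx with rfl | hx
  · simp
  · rw [Function.iterate_fixed hx]
    ring

theorem tailFunctional_sumRep {x : X} {z : ℂ} (hz : ‖z‖ < 1) (hx : z = 0 ∨ η (η x) = η x)
    (f : C₀(X, ℂ)) (ξ : HilbertSum X) :
    tailFunctional x hz (sumRep η f ξ) = f (η x) * tailFunctional x hz ξ := by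
  refine (hasSum_tailFunctional x hz _).unique ?_
  refine hasSum_of_eq ((hasSum_tailFunctional x hz ξ).mul_left (f (η x))) fun n => ?_
  rw [sumRep_apply, Function.iterate_succ_apply]
  rcases hx with rfl | hx
  · cases n <;> simp
  · rw [Function.iterate_fixed hx]
    ring

theorem tailFunctional_sumShiftRep {x : X} {z : ℂ} (hz : ‖z‖ < 1) (hx : z = 0 ∨ η (η x) = η x)
    (g : C₀(X, ℂ)) (ξ : HilbertSum X) :
    tailFunctional x hz (sumShiftRep η g ξ) =
      g x * ξ x 0 + z * g (η x) * tailFunctional x hz ξ := by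
  have h := hasSum_tailFunctional x hz (sumShiftRep η g ξ)
  rw [← hasSum_nat_add_iff' 1] at h
  simp only [Finset.sum_range_one, sumShiftRep_apply_succ, pow_zero, one_mul,
    Function.iterate_zero, id] at h
  rw [← sub_eq_iff_eq_add']
  refine h.unique ?_
  refine hasSum_of_eq ((hasSum_tailFunctional x hz ξ).mul_left (z * g (η x))) fun n => ?_
  rw [Function.iterate_succ_apply]
  rcases hx with rfl | hx
  · simp
  · rw [Function.iterate_fixed hx]
    ring

theorem powFunctional_apply {x : X} {z : ℂ} (hz : ‖z‖ < 1) (hx : z = 0 ∨ η x = x)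
    (a : semicrossedProduct η) (ξ : HilbertSum X) :
    powFunctional x hz (a.1 ξ) = powFunctional x hz (a.1 (vacuum x)) * powFunctional x hz ξ := by
  induction a using semicrossedProduct_induction generalizing ξ with
  | hp =>
    simp only [Set.ofPred_forall]
    refine isClosed_iInter fun ξ => isClosed_eq ?_ ?_ <;> fun_prop
  | hdiag f =>
    change powFunctional x hz (sumRep η f ξ) = powFunctional x hz (sumRep η f _) * _
    simp [powFunctional_sumRep hz hx, powFunctional_vacuum]
  | hoff g =>
    change powFunctional x hz (sumShiftRep η g ξ) = powFunctional x hz (sumShiftRep η g _) * _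
    simp [powFunctional_sumShiftRep hz hx, powFunctional_vacuum]
  | hadd a b ha hb =>
    change powFunctional x hz (a.1 ξ + b.1 ξ) = powFunctional x hz (a.1 _ + b.1 _) * _
    rw [map_add, map_add, ha, hb, add_mul]
  | hsmul c a ha =>
    change powFunctional x hz (c • a.1 ξ) = powFunctional x hz (c • a.1 _) * _
    rw [map_smul, map_smul, ha, smul_eq_mul, smul_eq_mul, mul_assoc]
  | hmul a b ha hb =>
    change powFunctional x hz (a.1 (b.1 ξ)) = powFunctional x hz (a.1 (b.1 _)) * _
    rw [ha, hb, ha (b.1 _), mul_assoc]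

/-- The character of the semicrossed product with `f ↦ f x` and `U g ↦ z g(x)`. -/
def diskCharacter {x : X} {z : ℂ} (hz : ‖z‖ < 1) (hx : z = 0 ∨ η x = x) :
    semicrossedProduct η →ₙₐ[ℂ] ℂ where
  toFun a := powFunctional x hz (a.1 (vacuum x))
  map_smul' c a := map_smul (powFunctional x hz) c (a.1 (vacuum x))
  map_zero' := map_zero (powFunctional x hz)
  map_add' a b := map_add (powFunctional x hz) (a.1 (vacuum x)) (b.1 (vacuum x))
  map_mul' a b := powFunctional_apply hz hx a (b.1 (vacuum x))

theorem diskCharacter_diag {x : X} {z : ℂ} (hz : ‖z‖ < 1) (hx : z = 0 ∨ η x = x) (f : C₀(X, ℂ)) :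
    diskCharacter hz hx (diag η f) = f x := by
  refine (powFunctional_sumRep hz hx f _).trans ?_
  rw [powFunctional_vacuum, mul_one]

theorem diskCharacter_off {x : X} {z : ℂ} (hz : ‖z‖ < 1) (hx : z = 0 ∨ η x = x) (g : C₀(X, ℂ)) :
    diskCharacter hz hx (off η g) = z * g x := by
  refine (powFunctional_sumShiftRep hz hx g _).trans ?_
  rw [powFunctional_vacuum, mul_one]

theorem diskCharacter_eq_tsum {x : X} {z : ℂ} (hz : ‖z‖ < 1) (hx : z = 0 ∨ η x = x)
    (a : semicrossedProduct η) :
    diskCharacter hz hx a = ∑' n, z ^ n * a.1 (vacuum x) x n :=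
  (hasSum_powFunctional x hz _).tsum_eq.symm

/-- The diagonal coefficient of an element depends continuously on the point. -/
theorem continuous_diskCharacter_zero (hη : IsProperMap η) (a : semicrossedProduct η) :
    Continuous fun x => diskCharacter (η := η) (x := x) (z := 0) (by simp) (Or.inl rfl) a := by
  obtain ⟨f, b, hab⟩ := exists_eq_diag_add_shift hη a
  convert f.continuous using 2 with x
  refine (powFunctional_zero x _).trans ?_
  rw [hab]
  change sumRep η f (vacuum x) x 0 + 0 = _
  simp [sumRep_apply, vacuum_apply_zero]

/-- The derivation of the semicrossed product over the pair `(x, η x)`. -/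
def tailDerivation (η : X → X) (x : X) {z : ℂ} (hz : ‖z‖ < 1) : semicrossedProduct η →ₗ[ℂ] ℂ where
  toFun a := tailFunctional x hz (a.1 (vacuum x))
  map_smul' c a := map_smul (tailFunctional x hz) c (a.1 (vacuum x))
  map_add' a b := map_add (tailFunctional x hz) (a.1 (vacuum x)) (b.1 (vacuum x))

theorem tailDerivation_diag {x : X} {z : ℂ} (hz : ‖z‖ < 1) (hx : z = 0 ∨ η (η x) = η x)
    (f : C₀(X, ℂ)) : tailDerivation η x hz (diag η f) = 0 := by
  refine (tailFunctional_sumRep hz hx f _).trans ?_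
  rw [tailFunctional_vacuum, mul_zero]

theorem tailDerivation_off {x : X} {z : ℂ} (hz : ‖z‖ < 1) (hx : z = 0 ∨ η (η x) = η x)
    (g : C₀(X, ℂ)) : tailDerivation η x hz (off η g) = g x := by
  refine (tailFunctional_sumShiftRep hz hx g _).trans ?_
  rw [tailFunctional_vacuum, vacuum_apply_zero, mul_zero, mul_one, add_zero]

theorem apply_apply_zero (x : X) (a : semicrossedProduct η) (ξ : HilbertSum X) :
    a.1 ξ x 0 =
      diskCharacter (η := η) (x := x) (z := 0) (by simp) (Or.inl rfl) a * ξ x 0 := by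
  have h := powFunctional_apply (η := η) (x := x) (z := 0) (by simp) (Or.inl rfl) a ξ
  rw [powFunctional_zero _ ξ, powFunctional_zero _ (a.1 ξ)] at h
  exact h

/-- The tail of the orbit of `x` is the orbit of `η x`. So `ξ ↦ ξ x 0` and the tail functional span
a space stable under composition with the algebra, giving a triangular `2 × 2` representation: the
characters over `x` and `η x` on its diagonal, `tailDerivation` off it. -/
theorem tailFunctional_apply {x : X} {z : ℂ} (hz : ‖z‖ < 1) (hx : z = 0 ∨ η (η x) = η x)
    (a : semicrossedProduct η) (ξ : HilbertSum X) :
    tailFunctional x hz (a.1 ξ) = tailDerivation η x hz a * ξ x 0 +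
      diskCharacter hz hx a * tailFunctional x hz ξ := by
  induction a using semicrossedProduct_induction generalizing ξ with
  | hp =>
    have hχ : Continuous (diskCharacter hz hx) := by
      change Continuous fun a : semicrossedProduct η => powFunctional (η x) hz (a.1 (vacuum (η x)))
      fun_prop
    simp only [Set.ofPred_forall]
    refine isClosed_iInter fun ξ => isClosed_eq (by fun_prop) ?_
    refine Continuous.add (Continuous.mul ?_ continuous_const)
      (hχ.mul continuous_const)
    change Continuous fun a : semicrossedProduct η => tailFunctional x hz (a.1 (vacuum x))
    fun_prop
  | hdiag f =>
    rw [tailDerivation_diag hz hx, diskCharacter_diag, zero_mul, zero_add]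
    exact tailFunctional_sumRep hz hx f ξ
  | hoff g =>
    rw [tailDerivation_off hz hx, diskCharacter_off]
    exact tailFunctional_sumShiftRep hz hx g ξ
  | hadd a b ha hb =>
    change tailFunctional x hz (a.1 ξ + b.1 ξ) = _
    rw [map_add, map_add, map_add, ha, hb]
    ring
  | hsmul c a ha =>
    change tailFunctional x hz (c • a.1 ξ) = _
    rw [map_smul, map_smul, map_smul, ha, smul_eq_mul, smul_eq_mul, smul_eq_mul]
    ring
  | hmul a b ha hb =>
    have hD : tailDerivation η x hz (a * b) = tailDerivation η x hz a * b.1 (vacuum x) x 0 +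
        diskCharacter hz hx a * tailDerivation η x hz b := ha (b.1 (vacuum x))
    change tailFunctional x hz (a.1 (b.1 ξ)) = _
    rw [hD, ha, hb, map_mul, apply_apply_zero x b, apply_apply_zero x b, vacuum_apply_zero]
    ring

theorem tailDerivation_mul {x : X} {z : ℂ} (hz : ‖z‖ < 1) (hx : z = 0 ∨ η (η x) = η x)
    (a b : semicrossedProduct η) :
    tailDerivation η x hz (a * b) = tailDerivation η x hz a *
        diskCharacter (η := η) (x := x) (z := 0) (by simp) (Or.inl rfl) b +
      diskCharacter hz hx a * tailDerivation η x hz b := by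
  have h : tailDerivation η x hz (a * b) = tailDerivation η x hz a * b.1 (vacuum x) x 0 +
      diskCharacter hz hx a * tailDerivation η x hz b :=
    tailFunctional_apply hz hx a (b.1 (vacuum x))
  rw [h, apply_apply_zero x b, vacuum_apply_zero, mul_one]

theorem norm_semicrossedProduct_character_le (χ : semicrossedProduct η →ₙₐ[ℂ] ℂ)
    (a : semicrossedProduct η) : ‖χ a‖ ≤ ‖a‖ :=
  norm_character_apply_le χ a

theorem continuous_semicrossedProduct_character (χ : semicrossedProduct η →ₙₐ[ℂ] ℂ) :
    Continuous χ := by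
  have h : ∀ a b, ‖χ a - χ b‖ ≤ ‖a.1 - b.1‖ := fun a b => by
    rw [← map_sub]
    exact norm_character_apply_le χ (a - b)
  refine continuous_iff_continuousAt.2 fun a => tendsto_iff_norm_sub_tendsto_zero.2 ?_
  refine squeeze_zero (fun _ => norm_nonneg _) (fun b => h b a) ?_
  have : Continuous fun b : semicrossedProduct η => ‖b.1 - a.1‖ := by fun_prop
  simpa using this.tendsto a

end Characters

end

/-! ### Coordinates of characters and rigidity of derivations -/

section

variable {X : Type*} [TopologicalSpace X] {η : X → X}

section Coordinates

/-- The functional takes the values `f x` at `f` and `w g(x)` at `U g`. -/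
structure HasCoords (χ : semicrossedProduct η →ₙₐ[ℂ] ℂ) (x : X) (w : ℂ) : Prop where
  diag : ∀ f, χ (diag η f) = f x
  off : ∀ g, χ (off η g) = w * g x

theorem hasCoords_diskCharacter {x : X} {z : ℂ} (hz : ‖z‖ < 1) (hx : z = 0 ∨ η x = x) :
    HasCoords (diskCharacter hz hx) x z :=
  ⟨diskCharacter_diag hz hx, diskCharacter_off hz hx⟩

/-- The character given by the diagonal coefficient at `x`. -/
abbrev zeroCharacter (η : X → X) (x : X) : semicrossedProduct η →ₙₐ[ℂ] ℂ :=
  diskCharacter (η := η) (x := x) (z := 0) (by simp) (Or.inl rfl)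

theorem hasCoords_zeroCharacter (η : X → X) (x : X) : HasCoords (zeroCharacter η x) x 0 :=
  hasCoords_diskCharacter _ _

theorem HasCoords.ext {χ χ' : semicrossedProduct η →ₙₐ[ℂ] ℂ} {x : X} {w : ℂ}
    (h : HasCoords χ x w) (h' : HasCoords χ' x w) : χ = χ' := by
  ext a
  induction a using semicrossedProduct_induction with
  | hp =>
    exact isClosed_eq (continuous_semicrossedProduct_character χ)
      (continuous_semicrossedProduct_character χ')
  | hdiag f => rw [h.diag, h'.diag]
  | hoff g => rw [h.off, h'.off]
  | hadd a b ha hb => rw [map_add, map_add, ha, hb]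
  | hsmul c a ha => rw [map_smul, map_smul, ha]
  | hmul a b ha hb => rw [map_mul, map_mul, ha, hb]

/-- Characters over a fixed point are radial limits of the characters of the open disk. -/
theorem HasCoords.tendsto_diskCharacter {χ : semicrossedProduct η →ₙₐ[ℂ] ℂ} {x : X} {w : ℂ}
    (h : HasCoords χ x w) {z : ℕ → ℂ} (hz : ∀ n, ‖z n‖ < 1) (hx : η x = x)
    (hzw : Tendsto z atTop (𝓝 w)) (a : semicrossedProduct η) :
    Tendsto (fun n => diskCharacter (hz n) (Or.inr hx) a) atTop (𝓝 (χ a)) := by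
  induction a using semicrossedProduct_induction with
  | hp =>
    -- Contractivity makes characters equicontinuous, so convergence is a closed condition on `a`.
    refine Equicontinuous.isClosed_setOfPred_tendsto
      (F := fun n a => diskCharacter (hz n) (Or.inr hx) a) (f := χ) ?_
      (continuous_semicrossedProduct_character χ)
    intro a
    rw [Metric.equicontinuousAt_iff_right]
    intro ε hε
    have hc : Continuous fun b : semicrossedProduct η => ‖a.1 - b.1‖ := by fun_prop
    have hlt : ∀ᶠ b in 𝓝 a, ‖a.1 - b.1‖ < ε :=
      hc.tendsto a (gt_mem_nhds (by simpa using hε))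
    refine hlt.mono fun b hb n => ?_
    rw [dist_eq_norm, ← map_sub]
    exact (norm_semicrossedProduct_character_le _ (a - b)).trans_lt hb
  | hdiag f =>
    simp only [diskCharacter_diag, h.diag]
    exact tendsto_const_nhds
  | hoff g =>
    simp only [diskCharacter_off, h.off]
    exact hzw.mul_const _
  | hadd a b ha hb =>
    simp only [map_add]
    exact ha.add hb
  | hsmul c a ha =>
    simp only [map_smul]
    exact ha.const_smul c
  | hmul a b ha hb =>
    simp only [map_mul]
    exact ha.mul hb

/-- The maximum modulus principle along the disk of characters over a fixed point. -/
theorem diskCharacter_eq_of_norm_eq {x : X} (hx : η x = x) (a : semicrossedProduct η) {C : ℝ}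
    (hle : ∀ (z : ℂ) (hz : ‖z‖ < 1), ‖diskCharacter hz (Or.inr hx) a‖ ≤ C)
    (h0 : ‖zeroCharacter η x a‖ = C) {z : ℂ} (hz : ‖z‖ < 1) :
    diskCharacter hz (Or.inr hx) a = zeroCharacter η x a := by
  have h := Complex.eqOn_of_isPreconnected_of_isMaxOn_norm (c := 0)
    (convex_ball (0 : ℂ) 1).isPreconnected Metric.isOpen_ball
    (differentiableOn_tsum_pow x (a.1 (vacuum x))) (by simp) (fun w hw => by
      have hw' : ‖w‖ < 1 := mem_ball_zero_iff.1 hw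
      have e1 := diskCharacter_eq_tsum hw' (Or.inr hx) a
      have e2 := diskCharacter_eq_tsum (η := η) (x := x) (z := 0) (by simp) (Or.inl rfl) a
      simp only [Function.comp_apply, Set.mem_ofPred_eq]
      rw [← e1, ← e2, h0]
      exact hle w hw')
  have hzz := h (mem_ball_zero_iff.2 hz)
  rw [diskCharacter_eq_tsum, diskCharacter_eq_tsum]
  exact hzz

/-- Multiplying by `k` turns `U b` into a product inside the algebra, where `U` alone need not lie.
This lets derivations be computed without assuming them continuous. -/
theorem exists_diag_mul_eq (hη : IsProperMap η) (k : C₀(X, ℂ)) (a : semicrossedProduct η) :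
    ∃ (f : C₀(X, ℂ)) (b : semicrossedProduct η), Semicrossed.diag η k * a =
      Semicrossed.diag η f + Semicrossed.off η (pullback hη k) * b := by
  obtain ⟨f, b, hab⟩ := exists_eq_diag_add_shift hη a
  refine ⟨k * f, b, Subtype.ext ?_⟩
  change sumRep η k * a.1 = sumRep η (k * f) + sumShiftRep η (pullback hη k) * b.1
  rw [hab, mul_add, sumRep_mul, ← mul_assoc, sumRep_mul_sumShift hη, sumShiftRep_eq]

variable [LocallyCompactSpace X] [T2Space X]

theorem HasCoords.eq {χ : semicrossedProduct η →ₙₐ[ℂ] ℂ} {x x' : X} {w w' : ℂ}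
    (h : HasCoords χ x w) (h' : HasCoords χ x' w') : x = x' ∧ w = w' := by
  have hxx : x = x' := eq_of_zeroAtInfty_apply_eq fun f => by rw [← h.diag, h'.diag]
  subst hxx
  obtain ⟨g, hg, -⟩ := exists_zeroAtInfty_apply_eq_one x
  have := (h.off g).symm.trans (h'.off g)
  rw [hg, mul_one, mul_one] at this
  exact ⟨rfl, this⟩

theorem exists_hasCoords (χ : semicrossedProduct η →ₙₐ[ℂ] ℂ) (hχ : ∃ a, χ a ≠ 0) :
    ∃ x w, HasCoords χ x w := by
  have hne : ∃ f, χ.comp (Semicrossed.diag η) f ≠ 0 := by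
    by_contra! h
    have h0 : ∀ f, χ (Semicrossed.diag η f) = 0 := h
    have h1 : ∀ g, χ (Semicrossed.off η g) = 0 := fun g => by
      refine norm_le_zero_iff.1 (le_of_forall_pos_le_add fun δ hδ => ?_)
      obtain ⟨k, hk⟩ := exists_norm_sub_mul_self_le g hδ
      -- `U k g` is `U k` times a diagonal element, which `χ` kills.
      have e : χ (Semicrossed.off η g) = χ (Semicrossed.off η (g - k * g)) := by
        rw [off_sub, map_sub, ← off_mul_diag, map_mul, h0, mul_zero, sub_zero]
      rw [e, zero_add]
      exact ((norm_semicrossedProduct_character_le χ _).trans (norm_off_le η _)).trans hk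
    obtain ⟨a, ha⟩ := hχ
    apply ha
    clear ha
    induction a using semicrossedProduct_induction with
    | hp => exact isClosed_eq (continuous_semicrossedProduct_character χ) continuous_const
    | hdiag f => exact h0 f
    | hoff g => exact h1 g
    | hadd a b ha hb => rw [map_add, ha, hb, add_zero]
    | hsmul c a ha => rw [map_smul, ha, smul_zero]
    | hmul a b ha hb => rw [map_mul, ha, zero_mul]
  obtain ⟨x, hx⟩ := exists_eq_eval_of_character _ hne
  have hx' : ∀ f, χ (Semicrossed.diag η f) = f x := hx
  obtain ⟨k, hk, -⟩ := exists_zeroAtInfty_apply_eq_one x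
  refine ⟨x, χ (Semicrossed.off η k), hx', fun g => ?_⟩
  rw [← hx' g, ← map_mul, off_mul_diag, mul_comm, ← off_mul_diag, map_mul, hx', hk, mul_one]

theorem HasCoords.norm_le {χ : semicrossedProduct η →ₙₐ[ℂ] ℂ} {x : X} {w : ℂ}
    (h : HasCoords χ x w) : ‖w‖ ≤ 1 := by
  obtain ⟨g, hg, hg'⟩ := exists_zeroAtInfty_apply_eq_one x
  have := h.off g
  rw [hg, mul_one] at this
  rw [← this]
  exact ((norm_semicrossedProduct_character_le χ _).trans (norm_off_le η _)).trans hg'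

/-- Apply the character to the covariance relation and cancel `w`. -/
theorem HasCoords.fixed (hη : IsProperMap η) {χ : semicrossedProduct η →ₙₐ[ℂ] ℂ} {x : X} {w : ℂ}
    (h : HasCoords χ x w) (hw : w ≠ 0) : η x = x := by
  refine eq_of_zeroAtInfty_apply_eq fun f => ?_
  obtain ⟨g, hg, -⟩ := exists_zeroAtInfty_apply_eq_one x
  have h1 := congrArg χ (diag_mul_off hη f g)
  rw [map_mul, map_mul, h.diag, h.off, h.diag, hg, mul_one, pullback_apply, mul_comm] at h1
  exact (mul_left_cancel₀ hw h1).symm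

theorem HasCoords.comp_ne_zero {χ : semicrossedProduct η →ₙₐ[ℂ] ℂ} {x : X} {w : ℂ}
    (h : HasCoords χ x w) {B : Type*} [NonUnitalRing B] [Module ℂ B]
    {φ : B →ₙₐ[ℂ] semicrossedProduct η} (hφ : Function.Surjective φ) :
    ∃ b, χ.comp φ b ≠ 0 := by
  obtain ⟨f, hf, -⟩ := exists_zeroAtInfty_apply_eq_one x
  obtain ⟨b, hb⟩ := hφ (Semicrossed.diag η f)
  refine ⟨b, ?_⟩
  rw [NonUnitalAlgHom.comp_apply, hb, h.diag, hf]
  exact one_ne_zero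

theorem comp_zeroCharacter_ne {B : Type*} [NonUnitalRing B] [Module ℂ B]
    {φ : B →ₙₐ[ℂ] semicrossedProduct η}
    (hφ : Function.Surjective φ) {x : X} (hx : η x = x) {z : ℂ} (hz : ‖z‖ < 1) (hz0 : z ≠ 0) :
    (zeroCharacter η x).comp φ ≠ (diskCharacter hz (Or.inr hx)).comp φ := by
  intro h
  have h' : zeroCharacter η x = diskCharacter hz (Or.inr hx) := by
    ext b
    obtain ⟨a, rfl⟩ := hφ b
    exact DFunLike.congr_fun h a
  have h1 := hasCoords_zeroCharacter η x
  rw [h'] at h1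
  exact hz0 (h1.eq (hasCoords_diskCharacter hz (Or.inr hx))).2.symm

/-- A derivation over two distinct points which is not inner forces the second point to be the
image of the first. -/
theorem eq_of_derivation (hη : IsProperMap η) {χp χq : semicrossedProduct η →ₙₐ[ℂ] ℂ} {p q : X}
    {w : ℂ} (hp : HasCoords χp p w) (hq : HasCoords χq q 0) (hpq : p ≠ q)
    {D : semicrossedProduct η → ℂ} (hadd : ∀ a b, D (a + b) = D a + D b)
    (hD : ∀ a b, D (a * b) = D a * χp b + χq a * D b)
    (hinner : ∀ c : ℂ, ∃ a, D a ≠ c * (χp a - χq a)) : q = η p := by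
  obtain ⟨u, hup, huq, -⟩ := exists_zeroAtInfty_separating hpq
  -- Subtracting the inner derivation with this `c` kills `u`, hence, by commutativity of `C₀(X)`,
  -- every diagonal element.
  set c : ℂ := D (Semicrossed.diag η u) with hc
  obtain ⟨E, hE⟩ : ∃ E : semicrossedProduct η → ℂ, ∀ a, E a = D a - c * (χp a - χq a) :=
    ⟨_, fun _ => rfl⟩
  have hEadd : ∀ a b, E (a + b) = E a + E b := fun a b => by
    simp only [hE, map_add, hadd]
    ring
  have hEmul : ∀ a b, E (a * b) = E a * χp b + χq a * E b := fun a b => by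
    simp only [hE, hD, map_mul]
    ring
  have hEdiag : ∀ f, E (Semicrossed.diag η f) = 0 := fun f => by
    have h1 := hD (Semicrossed.diag η f) (Semicrossed.diag η u)
    rw [← map_mul, mul_comm, map_mul, hD, hp.diag, hp.diag, hq.diag, hq.diag, hup, huq] at h1
    simp only [hE, hp.diag, hq.diag]
    linear_combination -h1
  -- The covariance relation again: `E` can be nonzero on some `U g` only if `q = η p`.
  have hEoff : ∀ f g : C₀(X, ℂ), f q * E (Semicrossed.off η g) = E (Semicrossed.off η g) * f (η p) :=
    fun f g => by
      have h1 := congrArg E (diag_mul_off hη f g)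
      rw [hEmul, hEmul, hEdiag, hEdiag, hp.diag, hq.diag, pullback_apply] at h1
      simpa using h1
  by_contra hne
  have hEoff0 : ∀ g, E (Semicrossed.off η g) = 0 := fun g => by
    obtain ⟨f, hf1, hf2, -⟩ := exists_zeroAtInfty_separating hne
    simpa [hf1, hf2] using hEoff f g
  obtain ⟨a, ha⟩ := hinner c
  refine ha (sub_eq_zero.1 ?_)
  rw [← hE]
  -- With `k q = 1`, `E (k a) = E a`. The remaining term `χq (U (k ∘ η)) * E b` vanishes because the
  -- second coordinate of `χq` is `0`.
  obtain ⟨k, hk, -⟩ := exists_zeroAtInfty_apply_eq_one q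
  obtain ⟨f, b, hka⟩ := exists_diag_mul_eq hη k a
  have h1 := congrArg E hka
  rw [hEmul, hEdiag, hq.diag, hk, hEadd, hEdiag, hEmul, hEoff0, hq.off] at h1
  simpa using h1

theorem exists_tailDerivation_ne {x : X} (hne : η x ≠ x) {z : ℂ} (hz : ‖z‖ < 1)
    (hx : z = 0 ∨ η (η x) = η x) (c : ℂ) :
    ∃ a, tailDerivation η x hz a ≠ c * (zeroCharacter η x a - diskCharacter hz hx a) := by
  by_contra! hall
  obtain ⟨f, hf1, hf2, -⟩ := exists_zeroAtInfty_separating (Ne.symm hne)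
  have h1 := hall (Semicrossed.diag η f)
  rw [tailDerivation_diag hz hx, diskCharacter_diag, diskCharacter_diag, hf1, hf2] at h1
  have h2 := hall (Semicrossed.off η f)
  rw [tailDerivation_off hz hx, hf1] at h2
  have hc : c = 0 := by simpa using h1.symm
  rw [hc, zero_mul] at h2
  exact one_ne_zero h2

end Coordinates

end

/-! ### The point map of an isomorphism -/

section PointMap

variable {X Y : Type*} [TopologicalSpace X] [LocallyCompactSpace X] [T2Space X]
  [TopologicalSpace Y] [LocallyCompactSpace Y] [T2Space Y] {η : X → X} {θ : Y → Y}

theorem exists_hasCoords_comp {φ : semicrossedProduct η →ₙₐ[ℂ] semicrossedProduct θ}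
    (hφ : Function.Surjective φ) {χ : semicrossedProduct θ →ₙₐ[ℂ] ℂ} {y : Y} {v : ℂ}
    (hχ : HasCoords χ y v) : ∃ x w, HasCoords (χ.comp φ) x w :=
  exists_hasCoords _ (hχ.comp_ne_zero hφ)

/-- The map on points induced by a surjective homomorphism of semicrossed products. -/
def pointMap {φ : semicrossedProduct η →ₙₐ[ℂ] semicrossedProduct θ}
    (hφ : Function.Surjective φ) (y : Y) : X :=
  (exists_hasCoords_comp hφ (hasCoords_zeroCharacter θ y)).choose

theorem pointMap_spec {φ : semicrossedProduct η →ₙₐ[ℂ] semicrossedProduct θ}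
    (hφ : Function.Surjective φ) (y : Y) :
    ∃ w, HasCoords ((zeroCharacter θ y).comp φ) (pointMap hφ y) w :=
  (exists_hasCoords_comp hφ (hasCoords_zeroCharacter θ y)).choose_spec

theorem eq_pointMap_of_diskCharacter {φ : semicrossedProduct η →ₙₐ[ℂ] semicrossedProduct θ}
    (hφ : Function.Surjective φ) {y : Y} (hy : θ y = y) {z : ℂ} (hz : ‖z‖ < 1) {x : X} {w : ℂ}
    (h : HasCoords ((diskCharacter hz (Or.inr hy)).comp φ) x w) : x = pointMap hφ y := by
  by_contra hne
  obtain ⟨v, hv⟩ := pointMap_spec hφ y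
  obtain ⟨f, hf1, hf2, hf⟩ := exists_zeroAtInfty_separating (Ne.symm hne)
  have h0 : zeroCharacter θ y (φ (diag η f)) = f (pointMap hφ y) := hv.diag f
  have hz0 : diskCharacter hz (Or.inr hy) (φ (diag η f)) = f x := h.diag f
  -- Along the disk, the values at the image of `f` are values of `f`, so bounded by `1`, and
  -- modulus `1` is attained at the centre. Hence they are constant, against `f x = 0`.
  have := diskCharacter_eq_of_norm_eq hy (φ (diag η f)) (C := 1) (fun z' hz' => by
    obtain ⟨x', w', h'⟩ := exists_hasCoords_comp hφ (hasCoords_diskCharacter hz' (Or.inr hy))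
    have e : diskCharacter hz' (Or.inr hy) (φ (diag η f)) = f x' := h'.diag f
    rw [e]
    exact (norm_zeroAtInfty_apply_le f x').trans hf) (by rw [h0, hf1, norm_one]) hz
  rw [h0, hz0, hf1, hf2] at this
  exact zero_ne_one this

/-- The points of a character and of its pullback are related by the point map. -/
theorem eq_pointMap (hθ : IsProperMap θ)
    {φ : semicrossedProduct η →ₙₐ[ℂ] semicrossedProduct θ} (hφ : Function.Surjective φ)
    {χ : semicrossedProduct θ →ₙₐ[ℂ] ℂ} {y : Y} {v : ℂ} (hχ : HasCoords χ y v)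
    {x : X} {w : ℂ} (h : HasCoords (χ.comp φ) x w) : x = pointMap hφ y := by
  obtain ⟨v', hv'⟩ := pointMap_spec hφ y
  by_cases hv : v = 0
  · subst hv
    rw [hχ.ext (hasCoords_zeroCharacter θ y)] at h
    exact (h.eq hv').1
  have hy := hχ.fixed hθ hv
  -- Scaling `v` by these factors reaches the case `‖v‖ = 1` as a radial limit from the open disk.
  have hr : ∀ n : ℕ, ‖(1 - 1 / ((n : ℝ) + 1) : ℝ)‖ < 1 := fun n => by
    have h1 : 0 < 1 / ((n : ℝ) + 1) := by positivity
    have h2 : 1 / ((n : ℝ) + 1) ≤ 1 :=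
      (div_le_one (by positivity)).2 (by linarith [n.cast_nonneg (α := ℝ)])
    rw [Real.norm_of_nonneg (by linarith)]
    linarith
  have hz : ∀ n : ℕ, ‖((1 - 1 / ((n : ℝ) + 1) : ℝ) : ℂ) * v‖ < 1 := fun n => by
    rw [norm_mul, Complex.norm_real]
    calc _ ≤ ‖(1 - 1 / ((n : ℝ) + 1) : ℝ)‖ * 1 := by
          gcongr
          exact hχ.norm_le
      _ < 1 := by simpa using hr n
  have hlim : Tendsto (fun n : ℕ => ((1 - 1 / ((n : ℝ) + 1) : ℝ) : ℂ) * v) atTop (𝓝 v) := by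
    have h1 : Tendsto (fun n : ℕ => (1 - 1 / ((n : ℝ) + 1) : ℝ)) atTop (𝓝 1) := by
      simpa using (tendsto_one_div_add_atTop_nhds_zero_nat (𝕜 := ℝ)).const_sub 1
    have h2 := ((Complex.continuous_ofReal.tendsto 1).comp h1).mul_const v
    simpa using h2
  refine eq_of_zeroAtInfty_apply_eq fun f => ?_
  have h1 := hχ.tendsto_diskCharacter hz hy hlim (φ (diag η f))
  have h2 : χ (φ (diag η f)) = f x := h.diag f
  have h3 : ∀ n, diskCharacter (hz n) (Or.inr hy) (φ (diag η f)) = f (pointMap hφ y) := fun n => by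
    obtain ⟨x', w', h'⟩ := exists_hasCoords_comp hφ (hasCoords_diskCharacter (hz n) (Or.inr hy))
    rw [← eq_pointMap_of_diskCharacter hφ hy (hz n) h']
    exact h'.diag f
  simp only [h2, h3] at h1
  exact tendsto_nhds_unique tendsto_const_nhds h1 |>.symm

theorem norm_half_lt_one : ‖(1 / 2 : ℂ)‖ < 1 := by norm_num

/-- Two distinct characters over `y`, with parameters `0` and `1/2`, pull back to distinct
characters over one point; a nonfixed point carries only one. -/
theorem pointMap_fixed (hη : IsProperMap η)
    {φ : semicrossedProduct η →ₙₐ[ℂ] semicrossedProduct θ} (hφ : Function.Surjective φ) {y : Y}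
    (hy : θ y = y) : η (pointMap hφ y) = pointMap hφ y := by
  by_contra hne
  obtain ⟨w, hw⟩ := pointMap_spec hφ y
  obtain ⟨x, w', hw'⟩ := exists_hasCoords_comp hφ
    (hasCoords_diskCharacter norm_half_lt_one (Or.inr hy))
  obtain rfl := eq_pointMap_of_diskCharacter hφ hy norm_half_lt_one hw'
  have h0 : w = 0 := by_contra fun h => hne (hw.fixed hη h)
  have h0' : w' = 0 := by_contra fun h => hne (hw'.fixed hη h)
  subst h0 h0'
  exact comp_zeroCharacter_ne hφ hy norm_half_lt_one (by norm_num) (hw.ext hw')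

theorem pointMap_pointMap (hη : IsProperMap η)
    {φ : semicrossedProduct η →ₙₐ[ℂ] semicrossedProduct θ} (hφ : Function.Surjective φ)
    {ψ : semicrossedProduct θ →ₙₐ[ℂ] semicrossedProduct η} (hψ : Function.Surjective ψ)
    (hφψ : ∀ b, φ (ψ b) = b) (y : Y) : pointMap hψ (pointMap hφ y) = y := by
  obtain ⟨w, hw⟩ := pointMap_spec hφ y
  have h : ((zeroCharacter θ y).comp φ).comp ψ = zeroCharacter θ y := by
    ext b
    exact congrArg (zeroCharacter θ y) (hφψ b)
  have h1 := hasCoords_zeroCharacter θ y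
  rw [← h] at h1
  exact (eq_pointMap hη hψ hw h1).symm

theorem continuous_pointMap (hθ : IsProperMap θ)
    {φ : semicrossedProduct η →ₙₐ[ℂ] semicrossedProduct θ} (hφ : Function.Surjective φ) :
    Continuous (pointMap hφ) := by
  refine continuous_of_zeroAtInfty_comp _ fun f => ?_
  refine (continuous_diskCharacter_zero hθ (φ (diag η f))).congr fun y => ?_
  obtain ⟨w, hw⟩ := pointMap_spec hφ y
  exact hw.diag f

/-- The maximum modulus principle for the second coordinate: if it had modulus `1` at the centre, it
would be constant on the disk and distinct characters would have equal pullbacks. Over a nonfixed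
`y` it is `0`. -/
theorem norm_coord_lt_one (hη : IsProperMap η)
    {φ : semicrossedProduct η →ₙₐ[ℂ] semicrossedProduct θ} (hφ : Function.Surjective φ)
    {ψ : semicrossedProduct θ →ₙₐ[ℂ] semicrossedProduct η} (hψ : Function.Surjective ψ)
    (hθ : IsProperMap θ) (hφψ : ∀ b, φ (ψ b) = b) {x : X} {y : Y} {w : ℂ}
    (h : HasCoords ((zeroCharacter θ y).comp φ) x w) : ‖w‖ < 1 := by
  obtain rfl := eq_pointMap hθ hφ (hasCoords_zeroCharacter θ y) h
  by_cases hy : θ y = y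
  · refine lt_of_le_of_ne h.norm_le fun hw => ?_
    obtain ⟨g, hg, -⟩ := exists_zeroAtInfty_apply_eq_one (pointMap hφ y)
    have hoff : ∀ {χ : semicrossedProduct θ →ₙₐ[ℂ] ℂ} {v : ℂ},
        HasCoords (χ.comp φ) (pointMap hφ y) v → χ (φ (off η g)) = v := fun hv => by
      have := hv.off g
      rwa [hg, mul_one] at this
    have hcoords : ∀ (z : ℂ) (hz : ‖z‖ < 1), ∃ v,
        HasCoords ((diskCharacter hz (Or.inr hy)).comp φ) (pointMap hφ y) v := fun z hz => by
      obtain ⟨x', v, hv⟩ := exists_hasCoords_comp hφ (hasCoords_diskCharacter hz (Or.inr hy))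
      obtain rfl := eq_pointMap_of_diskCharacter hφ hy hz hv
      exact ⟨v, hv⟩
    have hmax := diskCharacter_eq_of_norm_eq hy (φ (off η g)) (C := 1) (fun z hz => by
      obtain ⟨v, hv⟩ := hcoords z hz
      rw [hoff hv]
      exact hv.norm_le) (by rw [hoff h, hw]) norm_half_lt_one
    obtain ⟨v, hv⟩ := hcoords _ norm_half_lt_one
    rw [hoff hv, hoff h] at hmax
    subst hmax
    exact comp_zeroCharacter_ne hφ hy norm_half_lt_one (by norm_num) (h.ext hv)
  · have hw : w = 0 := by
      by_contra hw
      have h1 := pointMap_fixed hθ hψ (h.fixed hη hw)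
      rw [pointMap_pointMap hη hφ hψ hφψ] at h1
      exact hy h1
    rw [hw, norm_zero]
    exact one_pos

theorem pointMap_comm (hη : IsProperMap η)
    {φ : semicrossedProduct η →ₙₐ[ℂ] semicrossedProduct θ} (hφ : Function.Surjective φ)
    {ψ : semicrossedProduct θ →ₙₐ[ℂ] semicrossedProduct η} (hψ : Function.Surjective ψ)
    (hθ : IsProperMap θ) (hφψ : ∀ b, φ (ψ b) = b) (hψφ : ∀ a, ψ (φ a) = a) (y : Y) :
    pointMap hφ (θ y) = η (pointMap hφ y) := by
  by_cases hy : θ y = y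
  · rw [hy, pointMap_fixed hη hφ hy]
  have hne : pointMap hφ y ≠ pointMap hφ (θ y) := fun h => by
    have := congrArg (pointMap hψ) h
    rw [pointMap_pointMap hη hφ hψ hφψ, pointMap_pointMap hη hφ hψ hφψ] at this
    exact hy this.symm
  -- Choose the parameter `z` over `θ y` whose character pulls back under `φ` to second coordinate
  -- `0`, as `eq_of_derivation` requires. `θ y` may itself be fixed, so `z` need not be `0`.
  obtain ⟨y', z, hyz⟩ := exists_hasCoords_comp hψ (hasCoords_zeroCharacter η (pointMap hφ (θ y)))
  have hy' := eq_pointMap hη hψ (hasCoords_zeroCharacter η _) hyz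
  rw [pointMap_pointMap hη hφ hψ hφψ] at hy'
  subst hy'
  have hz : ‖z‖ < 1 := norm_coord_lt_one hθ hψ hφ hη hψφ hyz
  have hx : z = 0 ∨ θ (θ y) = θ y := or_iff_not_imp_left.2 fun h => hyz.fixed hθ h
  have hdisk : (diskCharacter hz hx).comp φ = zeroCharacter η (pointMap hφ (θ y)) := by
    rw [(hasCoords_diskCharacter hz hx).ext hyz]
    ext a
    exact congrArg (zeroCharacter η (pointMap hφ (θ y))) (hψφ a)
  have hq := hasCoords_zeroCharacter η (pointMap hφ (θ y))
  rw [← hdisk] at hq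
  obtain ⟨w, hp⟩ := pointMap_spec hφ y
  refine eq_of_derivation hη hp hq hne (D := fun a => tailDerivation θ y hz (φ a))
    (fun a b => ?_) (fun a b => ?_) fun c => ?_
  · exact (congrArg _ (map_add φ a b)).trans (map_add _ _ _)
  · exact (congrArg _ (map_mul φ a b)).trans (tailDerivation_mul hz hx (φ a) (φ b))
  · obtain ⟨b, hb⟩ := exists_tailDerivation_ne hy hz hx c
    obtain ⟨a, rfl⟩ := hφ b
    exact ⟨a, hb⟩

theorem conjugate_of_isomorphic (hη : IsProperMap η) (hθ : IsProperMap θ)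
    (φ : semicrossedProduct η →ₙₐ[ℂ] semicrossedProduct θ) (hφ : Function.Bijective φ) :
    Conjugate η θ := by
  obtain ⟨g, hgφ, hφg⟩ := Function.bijective_iff_has_inverse.1 hφ
  let ψ : semicrossedProduct θ →ₙₐ[ℂ] semicrossedProduct η := NonUnitalAlgHom.inverse φ g hgφ hφg
  have hψφ : ∀ a, ψ (φ a) = a := hgφ
  have hφψ : ∀ b, φ (ψ b) = b := hφg
  have hψ : Function.Surjective ψ := fun a => ⟨φ a, hψφ a⟩
  exact ⟨{  toFun := pointMap hψ
            invFun := pointMap hφ.2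
            left_inv := pointMap_pointMap hθ hψ hφ.2 hψφ
            right_inv := pointMap_pointMap hη hφ.2 hψ hφψ
            continuous_toFun := continuous_pointMap hη hψ
            continuous_invFun := continuous_pointMap hθ hφ.2 },
    pointMap_comm hθ hψ hφ.2 hη hψφ hφψ⟩

end PointMap

/-! ### From conjugacy to isomorphism -/

section Reindex

variable {X Y : Type*}

/-- The unitary permuting the summands along a bijection of the index sets. -/
def reindex (e : X ≃ Y) : HilbertSum X →ₗᵢ[ℂ] HilbertSum Y where
  toFun ξ := ⟨fun y => ξ (e.symm y), memℓp_gen (by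
    have h := (lp.hasSum_norm (p := 2) (by norm_num) ξ).summable
    exact (e.symm.summable_iff (f := fun x => ‖ξ x‖ ^ (2 : ℝ≥0∞).toReal)).2 h)⟩
  map_add' _ _ := rfl
  map_smul' _ _ := rfl
  norm_map' ξ := by
    have h2 : (0 : ℝ) < (2 : ℝ≥0∞).toReal := by norm_num
    refine (Real.rpow_left_inj (norm_nonneg _) (norm_nonneg _) h2.ne').1 ?_
    rw [lp.norm_rpow_eq_tsum h2, lp.norm_rpow_eq_tsum h2]
    exact e.symm.tsum_eq fun x => ‖ξ x‖ ^ (2 : ℝ≥0∞).toReal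

theorem reindex_apply (e : X ≃ Y) (ξ : HilbertSum X) (y : Y) : reindex e ξ y = ξ (e.symm y) := rfl

theorem reindex_symm_reindex (e : X ≃ Y) (ξ : HilbertSum X) :
    reindex e.symm (reindex e ξ) = ξ :=
  hilbertSum_ext fun x n => by simp [reindex_apply]

/-- Conjugation of operators by `reindex`. -/
def reindexConj (e : X ≃ Y) :
    (HilbertSum X →L[ℂ] HilbertSum X) →ₙₐ[ℂ] (HilbertSum Y →L[ℂ] HilbertSum Y) where
  toFun a := (reindex e).toContinuousLinearMap ∘L a ∘L (reindex e.symm).toContinuousLinearMap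
  map_smul' c a := by
    ext1 ξ
    exact map_smul (reindex e) c _
  map_zero' := by
    ext1 ξ
    exact map_zero (reindex e)
  map_add' a b := by
    ext1 ξ
    exact map_add (reindex e) _ _
  map_mul' a b := by
    ext1 ξ
    refine congrArg (fun ζ => reindex e (a ζ)) ?_
    exact (reindex_symm_reindex e _).symm

theorem continuous_reindexConj (e : X ≃ Y) : Continuous (reindexConj e) := by
  change Continuous fun a : HilbertSum X →L[ℂ] HilbertSum X =>
    (reindex e).toContinuousLinearMap ∘L a ∘L (reindex e.symm).toContinuousLinearMap
  fun_prop

theorem reindexConj_symm_reindexConj (e : X ≃ Y) (a : HilbertSum X →L[ℂ] HilbertSum X) :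
    reindexConj e.symm (reindexConj e a) = a := by
  ext1 ξ
  change reindex e.symm (reindex e (a (reindex e.symm (reindex e ξ)))) = a ξ
  rw [reindex_symm_reindex, reindex_symm_reindex]

variable [TopologicalSpace X] [TopologicalSpace Y] {η : X → X} {θ : Y → Y}

/-- The intertwining carries orbits to orbits, so each generator with symbol `f` goes to the one
with symbol `f ∘ h.symm`. -/
theorem reindexConj_mem (h : X ≃ₜ Y) (hh : ∀ x, h (η x) = θ (h x)) (a : semicrossedProduct η) :
    reindexConj h.toEquiv a.1 ∈ semicrossedProduct θ := by
  have hiter : ∀ n y, η^[n] (h.symm y) = h.symm (θ^[n] y) := fun n y => by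
    rw [Homeomorph.eq_symm_apply, (Function.Semiconj.iterate_right hh n), h.apply_symm_apply]
  let pull : C₀(X, ℂ) → C₀(Y, ℂ) := fun f =>
    f.comp ⟨⟨h.symm, h.symm.continuous⟩, h.symm.isClosedEmbedding.tendsto_cocompact⟩
  have hpull : ∀ f y, pull f y = f (h.symm y) := fun f y => rfl
  induction a using semicrossedProduct_induction with
  | hp =>
    exact (isClosed_semicrossedProduct θ).preimage
      ((continuous_reindexConj h.toEquiv).comp continuous_subtype_val)
  | hdiag f =>
    convert sumRep_mem θ (pull f)
    refine ContinuousLinearMap.ext fun ξ => hilbertSum_ext fun y n => ?_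
    change sumRep η f (reindex h.toEquiv.symm ξ) (h.symm y) n = _
    rw [sumRep_apply, sumRep_apply, hpull, hiter, reindex_apply]
    simp
  | hoff g =>
    convert sumShiftRep_mem θ (pull g)
    refine ContinuousLinearMap.ext fun ξ => hilbertSum_ext fun y n => ?_
    change sumShiftRep η g (reindex h.toEquiv.symm ξ) (h.symm y) n = _
    cases n with
    | zero => rfl
    | succ n =>
      rw [sumShiftRep_apply_succ, sumShiftRep_apply_succ, hpull, hiter, reindex_apply]
      simp
  | hadd a b ha hb =>
    change reindexConj h.toEquiv (a.1 + b.1) ∈ _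
    rw [map_add]
    exact add_mem ha hb
  | hsmul c a ha =>
    change reindexConj h.toEquiv (c • a.1) ∈ _
    rw [map_smul]
    exact SMulMemClass.smul_mem c ha
  | hmul a b ha hb =>
    change reindexConj h.toEquiv (a.1 * b.1) ∈ _
    rw [map_mul]
    exact mul_mem ha hb

theorem isomorphic_of_conjugate (h : Conjugate η θ) :
    IsomorphicAsAlgebras (semicrossedProduct η) (semicrossedProduct θ) := by
  obtain ⟨h, hh⟩ := h
  have hh' : ∀ y, h.symm (θ y) = η (h.symm y) := fun y => by
    rw [Homeomorph.symm_apply_eq, hh, h.apply_symm_apply]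
  refine ⟨{ toFun := fun a => ⟨reindexConj h.toEquiv a.1, reindexConj_mem h hh a⟩
            map_smul' := fun c a => Subtype.ext (map_smul (reindexConj h.toEquiv) c a.1)
            map_zero' := Subtype.ext (map_zero (reindexConj h.toEquiv))
            map_add' := fun a b => Subtype.ext (map_add (reindexConj h.toEquiv) a.1 b.1)
            map_mul' := fun a b => Subtype.ext (map_mul (reindexConj h.toEquiv) a.1 b.1) },
    Function.bijective_iff_has_inverse.2
      ⟨fun b => ⟨reindexConj h.symm.toEquiv b.1, reindexConj_mem h.symm hh' b⟩, fun a => ?_,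
        fun b => ?_⟩⟩
  · exact Subtype.ext (reindexConj_symm_reindexConj h.toEquiv a.1)
  · exact Subtype.ext (reindexConj_symm_reindexConj h.symm.toEquiv b.1)

end Reindex

end Semicrossed

end

theorem mainTheorem2 {X₁ X₂ : Type*}
    [TopologicalSpace X₁] [LocallyCompactSpace X₁] [T2Space X₁]
    [TopologicalSpace X₂] [LocallyCompactSpace X₂] [T2Space X₂]
    (η₁ : X₁ → X₁) (η₂ : X₂ → X₂) (hη₁ : IsProperMap η₁) (hη₂ : IsProperMap η₂) :
    Semicrossed.Conjugate η₁ η₂ ↔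
      Semicrossed.IsomorphicAsAlgebras
        (Semicrossed.semicrossedProduct η₁) (Semicrossed.semicrossedProduct η₂) :=
  ⟨Semicrossed.isomorphic_of_conjugate,
    fun ⟨φ, hφ⟩ => Semicrossed.conjugate_of_isomorphic hη₁ hη₂ φ hφ⟩
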